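/- For functions $m_1,m_2:]0,\infty[\to[0,\infty[$ write $m_1\preceq m_2$ if there are constants $C_1,C_2>0$ with $m_1(t)\le C_1\,m_2(C_2t)$ for all $t>0$, and $m_1\simeq m_2$ if $m_1\preceq m_2$ and $m_2\preceq m_1$. Given a symmetric operator $L$ on $L^2(X,\mu)$ with domain $\mathcal D(L)$ and $\Theta:]0,\infty[\to[0,\infty[$, we say that $$\Theta(\|f\|_2^2)\le (Lf,f)\qquad \text{for all } f\in\mathcal D(L) \text{ with } \|f\|_1=1$$ holds modulo equivalence if this inequality holds with $\Theta$ replaced by some function $\Theta'\simeq\Theta$. Theorem. Let $(X,\mu)$ be a measure space with $\sigma$-finite measure $\mu$, and let $A$ be a non-negative self-adjoint operator on $L^2(X,\mu)$ (real or complex scalars) with domain $\mathcal D(A)$ and spectral decomposition $A=\int_0^\infty\lambda\,dE_\lambda$. Suppose that the semigroup $e^{-tA}=\int_0^\infty e^{-t\lambda}\,dE_\lambda$ acts as a contraction on $L^1(X,\mu)$, that is, $\|e^{-tA}f\|_1\le\|f\|_1$ for all $t>0$ and $f\in L^1\cap L^2$. Let $B:[0,\infty[\to[0,\infty[$ be non-decreasing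 with $\lim_{x\to\infty}B(x)=\infty$, and suppose that, modulo equivalence (with $\Theta(x)=xB(x)$), $$\|f\|_2^2\,B(\|f\|_2^2)\le (Af,f),\qquad f\in\mathcal D(A),\ \|f\|_1=1.$$ Then for every $\alpha>0$, modulo equivalence (with $\Theta(x)=x[B(x)]^\alpha$), $$\|f\|_2^2\,\bigl[B(\|f\|_2^2)\bigr]^{\alpha}\le (A^{\alpha}f,f),\qquad f\in\mathcal D(A^{\alpha}),\ \|f\|_1=1,$$ where $A^\alpha=\int_0^\infty\lambda^\alpha\,dE_\lambda$ has domain $\mathcal D(A^\alpha)=\{f\in L^2:\int_0^\infty\lambda^{2\alpha}\,d(E_\lambda f,f)<\infty\}$. -/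

import Mathlib

open MeasureTheory Filter Topology
open scoped ENNReal NNReal InnerProductSpace

noncomputable section

/-- A resolution of the identity on the Hilbert space `H`: a projection-valued Borel measure on the
real line. The set function is defined on all sets, with value `0` on non-measurable ones. -/
structure SpectralMeasure (𝕜 H : Type*) [RCLike 𝕜] [NormedAddCommGroup H]
    [InnerProductSpace 𝕜 H] [CompleteSpace H] where
  /-- The projection `E(S)` of a Borel set `S`. -/
  proj : Set ℝ → H →L[𝕜] H
  not_measurable : ∀ S, ¬ MeasurableSet S → proj S = 0
  isStarProjection : ∀ S, MeasurableSet S → IsStarProjection (proj S)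
  proj_univ : proj Set.univ = 1
  proj_inter : ∀ S T, MeasurableSet S → MeasurableSet T → proj (S ∩ T) = proj S * proj T
  hasSum_proj : ∀ S : ℕ → Set ℝ, (∀ n, MeasurableSet (S n)) →
    Pairwise (fun m n => Disjoint (S m) (S n)) →
    ∀ f : H, HasSum (fun n => proj (S n) f) (proj (⋃ n, S n) f)

namespace SpectralMeasure

variable {𝕜 H : Type*} [RCLike 𝕜] [NormedAddCommGroup H] [InnerProductSpace 𝕜 H] [CompleteSpace H]
  (E : SpectralMeasure 𝕜 H)

/-- The `H`-valued vector measure `S ↦ E(S) f`. -/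
def vec (f : H) : VectorMeasure ℝ H where
  measureOf' S := E.proj S f
  empty' := by
    have h := E.hasSum_proj (fun _ => ∅) (fun _ => MeasurableSet.empty)
      (fun _ _ _ => disjoint_bot_left) f
    exact tendsto_nhds_unique tendsto_const_nhds h.summable.tendsto_atTop_zero
  not_measurable' S hS := by simp [E.not_measurable S hS]
  m_iUnion' S hS hd := E.hasSum_proj S hS hd f

theorem vec_apply (f : H) (S : Set ℝ) : E.vec f S = E.proj S f := rfl

theorem inner_proj_proj (f g : H) {S T : Set ℝ} (hS : MeasurableSet S) (hT : MeasurableSet T) :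
    ⟪E.proj S f, E.proj T g⟫_𝕜 = ⟪f, E.proj (S ∩ T) g⟫_𝕜 := by
  have h := (E.isStarProjection S hS).isSelfAdjoint
  rw [E.proj_inter S T hS hT, mul_apply_eq_comp,
    ← ContinuousLinearMap.adjoint_inner_right, ← ContinuousLinearMap.star_eq_adjoint, h.star_eq]

theorem inner_proj_self (f : H) {S : Set ℝ} (hS : MeasurableSet S) :
    RCLike.re ⟪E.proj S f, f⟫_𝕜 = ‖E.proj S f‖ ^ 2 := by
  rw [← inner_self_eq_norm_sq (𝕜 := 𝕜), E.inner_proj_proj f f hS hS, Set.inter_self, inner_re_symm]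

/-- The scalar spectral measure `d(E_λ f, f)`, that is, `S ↦ (E(S) f, f)`. -/
def scalar (f : H) : Measure ℝ :=
  Measure.ofMeasurable (fun S _ => ENNReal.ofReal (RCLike.re ⟪E.proj S f, f⟫_𝕜))
    (by
      have h : E.proj ∅ f = 0 := (E.vec f).empty
      simp [h])
    (by
      intro S hS hd
      have h := (E.hasSum_proj S hS hd f).mapL (innerSL 𝕜 f)
      have h2 := h.mapL (RCLike.reCLM (K := 𝕜))
      simp only [innerSL_apply_apply, RCLike.reCLM_apply] at h2
      simp only [inner_re_symm _ f]
      rw [← h2.tsum_eq, ENNReal.ofReal_tsum_of_nonneg _ h2.summable]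
      intro n
      rw [inner_re_symm, E.inner_proj_self f (hS n)]
      positivity)

theorem scalar_apply (f : H) {S : Set ℝ} (hS : MeasurableSet S) :
    E.scalar f S = ENNReal.ofReal (RCLike.re ⟪E.proj S f, f⟫_𝕜) :=
  Measure.ofMeasurable_apply S hS

theorem scalar_apply_eq_norm (f : H) {S : Set ℝ} (hS : MeasurableSet S) :
    E.scalar f S = ENNReal.ofReal (‖E.proj S f‖ ^ 2) := by
  rw [E.scalar_apply f hS, E.inner_proj_self f hS]

instance (f : H) : IsFiniteMeasure (E.scalar f) :=
  ⟨by rw [E.scalar_apply f MeasurableSet.univ]; exact ENNReal.ofReal_lt_top⟩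

theorem scalar_add_le (f g : H) :
    E.scalar (f + g) ≤ (2 : ℝ≥0∞) • E.scalar f + (2 : ℝ≥0∞) • E.scalar g := by
  refine Measure.le_iff.2 fun S hS => ?_
  rw [Measure.add_apply, Measure.smul_apply, Measure.smul_apply, E.scalar_apply_eq_norm _ hS,
    E.scalar_apply_eq_norm _ hS, E.scalar_apply_eq_norm _ hS, smul_eq_mul, smul_eq_mul, map_add,
    ← ENNReal.ofReal_ofNat 2, ← ENNReal.ofReal_mul (by norm_num), ← ENNReal.ofReal_mul (by norm_num),
    ← ENNReal.ofReal_add (by positivity) (by positivity)]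
  refine ENNReal.ofReal_le_ofReal ?_
  nlinarith [norm_add_le (E.proj S f) (E.proj S g), norm_nonneg (E.proj S f + E.proj S g),
    sq_nonneg (‖E.proj S f‖ - ‖E.proj S g‖), norm_nonneg (E.proj S f), norm_nonneg (E.proj S g)]

theorem scalar_smul (c : 𝕜) (f : H) :
    E.scalar (c • f) = ENNReal.ofReal (‖c‖ ^ 2) • E.scalar f := by
  ext S hS
  rw [Measure.smul_apply, E.scalar_apply_eq_norm _ hS, E.scalar_apply_eq_norm _ hS, smul_eq_mul,
    map_smul, norm_smul, mul_pow, ENNReal.ofReal_mul (by positivity)]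

/-- The integral `∑ r • E(s = r)` of a simple function `s` against `E`. -/
def simpleIntegral (s : SimpleFunc ℝ ℝ) : H →L[𝕜] H :=
  ∑ r ∈ s.range, (r : 𝕜) • E.proj (s ⁻¹' {r})

theorem simpleIntegral_map {γ : Type*} (F : SimpleFunc ℝ γ) (c : γ → ℝ) (f : H) :
    E.simpleIntegral (F.map c) f = ∑ y ∈ F.range, (c y : 𝕜) • E.proj (F ⁻¹' {y}) f := by
  classical
  simp only [simpleIntegral, FunLike.coe_sum, Finset.sum_apply, FunLike.coe_smul, Pi.smul_apply]
  rw [SimpleFunc.range_map]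
  rw [← Finset.sum_fiberwise_of_maps_to (s := F.range) (t := F.range.image c) (g := c)
    (fun y hy => Finset.mem_image_of_mem c hy)]
  refine Finset.sum_congr rfl fun r _ => ?_
  have h1 : E.proj ((F.map c) ⁻¹' {r}) f
      = ∑ y ∈ F.range with c y = r, E.proj (F ⁻¹' {y}) f := by
    have h2 := (E.vec f).of_biUnion_finset (s := {y ∈ F.range | c y = r})
      (f := fun y => F ⁻¹' {y})
      (by
        intro a _ b _ hab
        exact Disjoint.preimage _ (Set.disjoint_singleton.2 hab))
      (fun b _ => F.measurableSet_fiber b)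
    simp only [vec_apply] at h2
    rw [← h2]
    congr 2
    ext x
    simp
  rw [h1, Finset.smul_sum]
  refine Finset.sum_congr rfl fun y hy => ?_
  rw [(Finset.mem_filter.1 hy).2]

theorem norm_simpleIntegral_map {γ : Type*} (F : SimpleFunc ℝ γ) (c : γ → ℝ) (f : H) :
    ENNReal.ofReal (‖E.simpleIntegral (F.map c) f‖ ^ 2)
      = ∫⁻ x, ‖c (F x)‖ₑ ^ 2 ∂E.scalar f := by
  classical
  have h1 : ‖E.simpleIntegral (F.map c) f‖ ^ 2
      = ∑ y ∈ F.range, c y ^ 2 * ‖E.proj (F ⁻¹' {y}) f‖ ^ 2 := by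
    rw [E.simpleIntegral_map, ← inner_self_eq_norm_sq (𝕜 := 𝕜), sum_inner, map_sum]
    refine Finset.sum_congr rfl fun y hy => ?_
    rw [inner_sum, Finset.sum_eq_single y]
    · rw [inner_smul_left, inner_smul_right, ← mul_assoc, RCLike.conj_ofReal,
        ← RCLike.ofReal_mul, RCLike.re_ofReal_mul, inner_self_eq_norm_sq, sq (c y)]
    · intro z _ hz
      rw [inner_smul_left, inner_smul_right,
        E.inner_proj_proj _ _ (F.measurableSet_fiber y) (F.measurableSet_fiber z),
        ← Set.preimage_inter, Set.singleton_inter_eq_empty.2 (by simpa using hz.symm),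
        Set.preimage_empty]
      have h : E.proj ∅ f = 0 := (E.vec f).empty
      simp [h]
    · exact fun h => absurd hy h
  have h2 : ∫⁻ x, ‖c (F x)‖ₑ ^ 2 ∂E.scalar f
      = ∑ y ∈ F.range, ‖c y‖ₑ ^ 2 * E.scalar f (F ⁻¹' {y}) := by
    have h3 := SimpleFunc.lintegral_eq_lintegral (F.map fun y => ‖c y‖ₑ ^ 2) (E.scalar f)
    rw [SimpleFunc.map_lintegral] at h3
    exact h3
  rw [h1, h2, ENNReal.ofReal_sum_of_nonneg (fun y _ => by positivity)]
  refine Finset.sum_congr rfl fun y _ => ?_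
  rw [E.scalar_apply_eq_norm _ (F.measurableSet_fiber y), ENNReal.ofReal_mul (by positivity),
    Real.enorm_eq_ofReal_abs, ← ENNReal.ofReal_pow (abs_nonneg _), sq_abs]

theorem edist_simpleIntegral (s t : SimpleFunc ℝ ℝ) (f : H) :
    edist (E.simpleIntegral s f) (E.simpleIntegral t f)
      = eLpNorm (⇑s - ⇑t) 2 (E.scalar f) := by
  have hs : E.simpleIntegral s f = E.simpleIntegral ((s.pair t).map Prod.fst) f := by
    congr 1
  have ht : E.simpleIntegral t f = E.simpleIntegral ((s.pair t).map Prod.snd) f := by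
    congr 1
  have h1 : E.simpleIntegral s f - E.simpleIntegral t f
      = E.simpleIntegral ((s.pair t).map fun y => y.1 - y.2) f := by
    rw [hs, ht, E.simpleIntegral_map, E.simpleIntegral_map, E.simpleIntegral_map,
      ← Finset.sum_sub_distrib]
    refine Finset.sum_congr rfl fun y _ => ?_
    rw [← sub_smul, RCLike.ofReal_sub]
  have h2 := E.norm_simpleIntegral_map (s.pair t) (fun y => y.1 - y.2) f
  rw [edist_eq_enorm_sub, h1, eLpNorm_eq_lintegral_rpow_enorm_toReal two_ne_zero
    ENNReal.ofNat_ne_top]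
  simp only [ENNReal.toReal_ofNat, ENNReal.rpow_ofNat, Pi.sub_apply]
  change _ = (∫⁻ x, ‖s x - t x‖ₑ ^ 2 ∂E.scalar f) ^ _
  change _ = ∫⁻ x, ‖s x - t x‖ₑ ^ 2 ∂E.scalar f at h2
  rw [← h2, ENNReal.ofReal_pow (norm_nonneg _), ofReal_norm, ← ENNReal.rpow_natCast,
    ← ENNReal.rpow_mul]
  norm_num

/-- Simple functions converging to `φ` pointwise, and in every `L²(ν)` that contains `φ`. -/
def approx (φ : ℝ → ℝ) (hφ : Measurable φ) (n : ℕ) : SimpleFunc ℝ ℝ :=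
  SimpleFunc.approxOn φ hφ Set.univ 0 (Set.mem_univ 0) n

theorem tendsto_approx (φ : ℝ → ℝ) (hφ : Measurable φ) (ν : Measure ℝ)
    (h : ∫⁻ x, ‖φ x‖ₑ ^ 2 ∂ν < ∞) :
    Tendsto (fun n => eLpNorm (⇑(approx φ hφ n) - φ) 2 ν) atTop (𝓝 0) := by
  refine SimpleFunc.tendsto_approxOn_Lp_eLpNorm hφ _ ENNReal.ofNat_ne_top (by simp) ?_
  rw [eLpNorm_lt_top_iff_lintegral_rpow_enorm_lt_top two_ne_zero ENNReal.ofNat_ne_top]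
  simpa using h

theorem exists_tendsto_simpleIntegral (φ : ℝ → ℝ) (hφ : Measurable φ) (f : H)
    (h : ∫⁻ x, ‖φ x‖ₑ ^ 2 ∂E.scalar f < ∞) :
    ∃ g, Tendsto (fun n => E.simpleIntegral (approx φ hφ n) f) atTop (𝓝 g) := by
  refine cauchySeq_tendsto_of_complete ?_
  have h0 := tendsto_approx φ hφ _ h
  refine EMetric.cauchySeq_iff.2 fun ε hε => ?_
  obtain ⟨r, hr, hrε⟩ := ENNReal.lt_iff_exists_nnreal_btwn.1 hε
  obtain ⟨N, hN⟩ := ENNReal.tendsto_atTop_zero.1 h0 (r / 2) (ENNReal.div_pos hr.ne' (by simp))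
  have hm : ∀ n, AEStronglyMeasurable (⇑(approx φ hφ n) - φ) (E.scalar f) := fun n =>
    ((approx φ hφ n).measurable.sub hφ).aestronglyMeasurable
  refine ⟨N, fun m hm' n hn' => ?_⟩
  rw [E.edist_simpleIntegral, ← sub_sub_sub_cancel_right _ _ φ]
  refine (eLpNorm_sub_le (hm m) (hm n) (by norm_num)).trans_lt ?_
  refine (add_le_add (hN m hm') (hN n hn')).trans_lt ?_
  rwa [ENNReal.add_halves]

/-- The operator `∫ φ dE` on its natural domain `{f : ∫ φ² d(E_λ f, f) < ∞}`. -/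
def integral (φ : ℝ → ℝ) (hφ : Measurable φ) : H →ₗ.[𝕜] H where
  domain :=
    { carrier := {f | ∫⁻ x, ‖φ x‖ₑ ^ 2 ∂E.scalar f < ∞}
      zero_mem' := by
        change ∫⁻ x, ‖φ x‖ₑ ^ 2 ∂E.scalar 0 < ∞
        have h : E.scalar 0 = 0 := by
          ext S hS
          simp [E.scalar_apply _ hS]
        simp [h]
      add_mem' := by
        intro f g hf hg
        refine (lintegral_mono' (E.scalar_add_le f g) le_rfl).trans_lt ?_
        rw [lintegral_add_measure, lintegral_smul_measure, lintegral_smul_measure]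
        exact ENNReal.add_lt_top.2 ⟨ENNReal.mul_lt_top (by simp) hf, ENNReal.mul_lt_top (by simp) hg⟩
      smul_mem' := by
        intro c f hf
        change ∫⁻ x, ‖φ x‖ₑ ^ 2 ∂E.scalar (c • f) < ∞
        rw [E.scalar_smul, lintegral_smul_measure]
        exact ENNReal.mul_lt_top ENNReal.ofReal_lt_top hf }
  toFun :=
    { toFun := fun f => limUnder atTop fun n => E.simpleIntegral (approx φ hφ n) (f : H)
      map_add' := by
        intro f g
        have hf := tendsto_nhds_limUnder (E.exists_tendsto_simpleIntegral φ hφ f f.2)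
        have hg := tendsto_nhds_limUnder (E.exists_tendsto_simpleIntegral φ hφ g g.2)
        refine Tendsto.limUnder_eq ?_
        simpa using hf.add hg
      map_smul' := by
        intro c f
        have hf := tendsto_nhds_limUnder (E.exists_tendsto_simpleIntegral φ hφ f f.2)
        refine Tendsto.limUnder_eq ?_
        simpa using hf.const_smul c }

/-- The defining formula `(∫ φ dE f, f) = ∫ φ d(E_λ f, f)` on the domain. -/
theorem inner_integral_self (φ : ℝ → ℝ) (hφ : Measurable φ) (f : (E.integral φ hφ).domain) :
    ⟪(f : H), E.integral φ hφ f⟫_𝕜 = ((∫ x, φ x ∂E.scalar (f : H) : ℝ) : 𝕜) := by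
  have hmem : ∫⁻ x, ‖φ x‖ₑ ^ 2 ∂E.scalar (f : H) < ∞ := f.2
  have h0 := tendsto_nhds_limUnder (E.exists_tendsto_simpleIntegral φ hφ f hmem)
  have h1 : Tendsto (fun n => ⟪(f : H), E.simpleIntegral (approx φ hφ n) (f : H)⟫_𝕜) atTop
      (𝓝 ⟪(f : H), E.integral φ hφ f⟫_𝕜) :=
    ((innerSL 𝕜 (f : H)).continuous.tendsto _).comp h0
  have hL2 : MemLp φ 2 (E.scalar (f : H)) := by
    refine ⟨hφ.aestronglyMeasurable, ?_⟩
    rw [eLpNorm_lt_top_iff_lintegral_rpow_enorm_lt_top two_ne_zero ENNReal.ofNat_ne_top]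
    simpa using hmem
  have h2 : Tendsto (fun n => ∫ x, approx φ hφ n x ∂E.scalar (f : H)) atTop
      (𝓝 (∫ x, φ x ∂E.scalar (f : H))) := by
    refine tendsto_integral_of_L1' φ hφ.aestronglyMeasurable (Eventually.of_forall fun n =>
      (SimpleFunc.integrable_of_isFiniteMeasure _)) ?_
    refine SimpleFunc.tendsto_approxOn_Lp_eLpNorm hφ _ ENNReal.one_ne_top (by simp) ?_
    simpa using (memLp_one_iff_integrable.2 (hL2.integrable (by norm_num))).2
  have h3 : ∀ s : SimpleFunc ℝ ℝ, ⟪(f : H), E.simpleIntegral s (f : H)⟫_𝕜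
      = ((∫ x, s x ∂E.scalar (f : H) : ℝ) : 𝕜) := by
    intro s
    rw [← SimpleFunc.integral_eq_integral _ (SimpleFunc.integrable_of_isFiniteMeasure _),
      SimpleFunc.integral_eq]
    simp only [simpleIntegral, FunLike.coe_sum, Finset.sum_apply, FunLike.coe_smul, Pi.smul_apply]
    rw [inner_sum, RCLike.ofReal_sum]
    refine Finset.sum_congr rfl fun r _ => ?_
    have hS := s.measurableSet_fiber r
    have h4 := E.inner_proj_proj (f : H) (f : H) hS hS
    rw [Set.inter_self] at h4
    rw [inner_smul_right, ← h4, inner_self_eq_norm_sq_to_K, measureReal_def,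
      E.scalar_apply_eq_norm _ hS, ENNReal.toReal_ofReal (by positivity)]
    simp [mul_comm]
  refine tendsto_nhds_unique h1 ?_
  simp only [h3]
  exact (RCLike.continuous_ofReal.tendsto _).comp h2

end SpectralMeasure

namespace LinearPMap

section FunctionalCalculus

variable {𝕜 H : Type*} [RCLike 𝕜] [NormedAddCommGroup H] [InnerProductSpace 𝕜 H] [CompleteSpace H]

open Classical in
/-- The function `φ(A) = ∫ φ(λ) dE_λ` of a self-adjoint operator `A = ∫ λ dE_λ`, where `E` is the
spectral resolution of `A`. By the spectral theorem `E` exists, and is unique, for every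
self-adjoint `A`; for other operators the value `⊥`, with domain `{0}`, carries no meaning. -/
def borelCalculus (A : H →ₗ.[𝕜] H) (φ : ℝ → ℝ) (hφ : Measurable φ) : H →ₗ.[𝕜] H :=
  if h : ∃ E : SpectralMeasure 𝕜 H, E.integral (fun x => x) measurable_id = A then
    h.choose.integral φ hφ
  else ⊥

/-- The operator `e^{-tA}`. -/
def expNeg (A : H →ₗ.[𝕜] H) (t : ℝ) : H →ₗ.[𝕜] H :=
  A.borelCalculus (fun x => Real.exp (-t * x)) (by fun_prop)

/-- The fractional power `A^α` of a non-negative self-adjoint operator. -/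
def fracPow (A : H →ₗ.[𝕜] H) (α : ℝ) : H →ₗ.[𝕜] H :=
  A.borelCalculus (fun x => x ^ α) (by fun_prop)

end FunctionalCalculus

end LinearPMap

/-- `m₁ ≼ m₂`, for non-negative functions on the positive half-line. -/
def FunDominated (m₁ m₂ : ℝ≥0 → ℝ≥0) : Prop :=
  ∃ C₁ > 0, ∃ C₂ > 0, ∀ t > 0, m₁ t ≤ C₁ * m₂ (C₂ * t)

/-- `m₁ ≃ m₂`: equivalence of functions up to constants inside and outside. -/
def FunEquiv (m₁ m₂ : ℝ≥0 → ℝ≥0) : Prop :=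
  FunDominated m₁ m₂ ∧ FunDominated m₂ m₁

section Nash

variable {𝕜 : Type*} [RCLike 𝕜] {X : Type*} [MeasurableSpace X] {μ : Measure X}

/-- The operators `e^{-tA}`, `t > 0`, on `L²(X, μ)` act as contractions on `L¹(X, μ)`. -/
def IsL1Contractive (A : Lp 𝕜 2 μ →ₗ.[𝕜] Lp 𝕜 2 μ) : Prop :=
  ∀ t : ℝ, 0 < t → ∀ f : (A.expNeg t).domain,
    eLpNorm (A.expNeg t f) 1 μ ≤ eLpNorm (f : Lp 𝕜 2 μ) 1 μ

/-- The inequality `Θ(‖f‖₂²) ≤ (Af, f)` for all `f` in the domain of `A` with `‖f‖₁ = 1`. -/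
def NashInequality (A : Lp 𝕜 2 μ →ₗ.[𝕜] Lp 𝕜 2 μ) (Θ : ℝ≥0 → ℝ≥0) : Prop :=
  ∀ f : A.domain, eLpNorm (f : Lp 𝕜 2 μ) 1 μ = 1 →
    (Θ (‖(f : Lp 𝕜 2 μ)‖₊ ^ 2) : ℝ) ≤ RCLike.re ⟪A f, (f : Lp 𝕜 2 μ)⟫_𝕜

/-- The inequality `Θ(‖f‖₂²) ≤ (Af, f)`, for `‖f‖₁ = 1`, modulo equivalence of functions. -/
def NashInequalityModEquiv (A : Lp 𝕜 2 μ →ₗ.[𝕜] Lp 𝕜 2 μ) (Θ : ℝ≥0 → ℝ≥0) : Prop :=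
  ∃ Θ' : ℝ≥0 → ℝ≥0, FunEquiv Θ' Θ ∧ NashInequality A Θ'

end Nash

end

open MeasureTheory Filter Topology
open scoped ENNReal NNReal InnerProductSpace

/-! ### Spectral calculus: isometry, spectral measure of `φ(A) f`, support of the spectral measure.
-/

namespace SpectralMeasure

variable {𝕜 H : Type*} [RCLike 𝕜] [NormedAddCommGroup H] [InnerProductSpace 𝕜 H] [CompleteSpace H]
  (E : SpectralMeasure 𝕜 H)

/-! The Nash inequality is turned into decay of the semigroup at one well-chosen time, and decay
into a lower bound for `(A^α f, f)`. Let `‖f‖₁ = 1`, `s = ‖f‖₂²`, `b = B(ks/4)` and `g = e^{-tA} f`.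
Since `‖g‖₁ ≤ 1`, the hypothesis, rescaled, applies to `g` (`NashInequality.le_of_eLpNorm_le_one`).
If `‖g‖² > s/4`, it gives `(Ag, g) ≥ c b ‖g‖²` by monotonicity of `B`, while `2t (Ag, g) ≤ s - ‖g‖²`
(`energy_exp_le`). With `2tcb = 3` these contradict each other, so `‖g‖² ≤ s/4`. Thus much of the
spectral mass of `f` lies at energies of order at least `1/t`, that is, of order `b`, and `(A^α f,
f)` is at least a multiple of `b^α s` (`rpow_energy_ge`). No differential inequality in `t` is
solved, and the same argument serves all `α > 0`. -/

theorem mem_domain_integral {φ : ℝ → ℝ} {hφ : Measurable φ} {f : H} :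
    f ∈ (E.integral φ hφ).domain ↔ ∫⁻ x, ‖φ x‖ₑ ^ 2 ∂E.scalar f < ∞ := Iff.rfl

theorem scalar_univ (f : H) : E.scalar f Set.univ = ENNReal.ofReal (‖f‖ ^ 2) := by
  rw [E.scalar_apply_eq_norm f MeasurableSet.univ, E.proj_univ]
  rfl

/-- Compressing the vector by `E(S)` restricts its scalar spectral measure to `S`. -/
theorem scalar_proj (f : H) {S : Set ℝ} (hS : MeasurableSet S) :
    E.scalar (E.proj S f) = (E.scalar f).restrict S := by
  ext T hT
  rw [Measure.restrict_apply hT, E.scalar_apply_eq_norm _ hT,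
    E.scalar_apply_eq_norm _ (hT.inter hS), E.proj_inter T S hT hS]
  rfl

/-- Spectral projections commute, both products being the projection of the intersection. -/
theorem simpleIntegral_proj (s : SimpleFunc ℝ ℝ) (f : H) {S : Set ℝ} (hS : MeasurableSet S) :
    E.simpleIntegral s (E.proj S f) = E.proj S (E.simpleIntegral s f) := by
  simp only [simpleIntegral, FunLike.coe_sum, Finset.sum_apply, FunLike.coe_smul, Pi.smul_apply,
    map_sum, map_smul]
  refine Finset.sum_congr rfl fun r _ => ?_
  congr 1
  have h := s.measurableSet_fiber r
  have h1 := congrArg (fun P => P f) (E.proj_inter _ S h hS)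
  have h2 := congrArg (fun P => P f) (E.proj_inter S _ hS h)
  rw [Set.inter_comm] at h2
  exact h1.symm.trans h2

theorem tendsto_simpleIntegral {φ : ℝ → ℝ} {hφ : Measurable φ} (f : (E.integral φ hφ).domain) :
    Tendsto (fun n => E.simpleIntegral (approx φ hφ n) (f : H)) atTop
      (𝓝 (E.integral φ hφ f)) :=
  tendsto_nhds_limUnder (E.exists_tendsto_simpleIntegral φ hφ f f.2)

theorem enorm_simpleIntegral (s : SimpleFunc ℝ ℝ) (f : H) :
    ‖E.simpleIntegral s f‖ₑ = eLpNorm s 2 (E.scalar f) := by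
  have h := E.edist_simpleIntegral s 0 f
  have h0 : E.simpleIntegral 0 f = 0 := by
    have h1 := E.norm_simpleIntegral_map (0 : SimpleFunc ℝ ℝ) (fun _ => 0) f
    have h2 : (0 : SimpleFunc ℝ ℝ).map (fun _ => (0 : ℝ)) = 0 := by ext; simp
    rw [h2] at h1
    simp only [enorm_zero, ne_eq, OfNat.ofNat_ne_zero, not_false_eq_true, zero_pow,
      lintegral_zero, ENNReal.ofReal_eq_zero] at h1
    have h3 : ‖E.simpleIntegral 0 f‖ = 0 := by nlinarith [norm_nonneg (E.simpleIntegral 0 f)]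
    exact norm_eq_zero.1 h3
  rw [h0, edist_zero_right] at h
  simpa using h

/-- The isometry property `‖∫ φ dE f‖² = ∫ |φ|² d(E_λ f, f)`. -/
theorem enorm_integral_sq {φ : ℝ → ℝ} {hφ : Measurable φ} (f : (E.integral φ hφ).domain) :
    ‖E.integral φ hφ f‖ₑ ^ 2 = ∫⁻ x, ‖φ x‖ₑ ^ 2 ∂E.scalar (f : H) := by
  have hmem : ∫⁻ x, ‖φ x‖ₑ ^ 2 ∂E.scalar (f : H) < ∞ := f.2
  have hφ2 : MemLp φ 2 (E.scalar (f : H)) := by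
    refine ⟨hφ.aestronglyMeasurable, ?_⟩
    rw [eLpNorm_lt_top_iff_lintegral_rpow_enorm_lt_top two_ne_zero ENNReal.ofNat_ne_top]
    simpa using hmem
  have h1 : Tendsto (fun n => ‖E.simpleIntegral (approx φ hφ n) (f : H)‖ₑ) atTop
      (𝓝 ‖E.integral φ hφ f‖ₑ) := (E.tendsto_simpleIntegral f).enorm
  have h2 : Tendsto (fun n => eLpNorm (approx φ hφ n) 2 (E.scalar (f : H))) atTop
      (𝓝 (eLpNorm φ 2 (E.scalar (f : H)))) := by
    have h3 := tendsto_approx φ hφ _ hmem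
    have hm : ∀ n, AEStronglyMeasurable (⇑(approx φ hφ n)) (E.scalar (f : H)) := fun n =>
      (approx φ hφ n).measurable.aestronglyMeasurable
    -- The two triangle inequalities squeeze the norms of the approximants towards the norm of `φ`.
    have lower : ∀ n, eLpNorm φ 2 (E.scalar (f : H)) - eLpNorm (⇑(approx φ hφ n) - φ) 2
        (E.scalar (f : H)) ≤ eLpNorm (approx φ hφ n) 2 (E.scalar (f : H)) := by
      intro n
      rw [tsub_le_iff_right]
      have h4 := eLpNorm_sub_le (hm n) ((hm n).sub hφ2.1) (p := 2) (by norm_num)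
      rwa [sub_sub_cancel] at h4
    have upper : ∀ n, eLpNorm (approx φ hφ n) 2 (E.scalar (f : H))
        ≤ eLpNorm φ 2 (E.scalar (f : H)) + eLpNorm (⇑(approx φ hφ n) - φ) 2
        (E.scalar (f : H)) := by
      intro n
      have h4 := eLpNorm_add_le hφ2.1 ((hm n).sub hφ2.1) (p := 2) (by norm_num)
      rwa [add_sub_cancel] at h4
    refine tendsto_of_tendsto_of_tendsto_of_le_of_le ?_ ?_ lower upper
    · simpa using ENNReal.Tendsto.sub (tendsto_const_nhds (x := eLpNorm φ 2 (E.scalar (f : H)))) h3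
        (Or.inl hφ2.2.ne)
    · simpa using (tendsto_const_nhds (x := eLpNorm φ 2 (E.scalar (f : H)))).add h3
  simp only [E.enorm_simpleIntegral] at h1
  rw [tendsto_nhds_unique h1 h2, eLpNorm_eq_lintegral_rpow_enorm_toReal two_ne_zero
    ENNReal.ofNat_ne_top, ← ENNReal.rpow_natCast, ← ENNReal.rpow_mul]
  simp

theorem proj_integral {φ : ℝ → ℝ} {hφ : Measurable φ} (f : (E.integral φ hφ).domain) {S : Set ℝ}
    (hS : MeasurableSet S) (hf : E.proj S (f : H) ∈ (E.integral φ hφ).domain) :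
    E.proj S (E.integral φ hφ f) = E.integral φ hφ ⟨E.proj S (f : H), hf⟩ := by
  have h1 := ((E.proj S).continuous.tendsto _).comp (E.tendsto_simpleIntegral f)
  have h2 := E.tendsto_simpleIntegral ⟨E.proj S (f : H), hf⟩
  simp only [E.simpleIntegral_proj _ _ hS] at h2
  exact tendsto_nhds_unique h1 h2

/-- The scalar spectral measure of `φ(A) f` has density `φ²` with respect to that of `f`. -/
theorem scalar_integral {φ : ℝ → ℝ} {hφ : Measurable φ} (f : (E.integral φ hφ).domain) :
    E.scalar (E.integral φ hφ f) = (E.scalar (f : H)).withDensity fun x => ‖φ x‖ₑ ^ 2 := by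
  ext S hS
  have hf : E.proj S (f : H) ∈ (E.integral φ hφ).domain := by
    rw [mem_domain_integral, E.scalar_proj _ hS]
    exact (setLIntegral_le_lintegral _ _).trans_lt f.2
  rw [withDensity_apply _ hS, ← E.scalar_proj _ hS, E.scalar_apply_eq_norm _ hS,
    E.proj_integral f hS hf, ENNReal.ofReal_pow (norm_nonneg _), ofReal_norm, E.enorm_integral_sq]

theorem re_inner_integral_self {φ : ℝ → ℝ} {hφ : Measurable φ} (f : (E.integral φ hφ).domain) :
    RCLike.re ⟪E.integral φ hφ f, (f : H)⟫_𝕜 = ∫ x, φ x ∂E.scalar (f : H) := by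
  rw [inner_re_symm, E.inner_integral_self, RCLike.ofReal_re]

/-- The spectral measure of a non-negative operator is carried by the half-line `[0, ∞)`. -/
theorem ae_nonneg_of_nonneg
    (h : ∀ f : (E.integral (fun x => x) measurable_id).domain,
      0 ≤ RCLike.re ⟪E.integral (fun x => x) measurable_id f, (f : H)⟫_𝕜) (f : H) :
    ∀ᵐ x ∂E.scalar f, 0 ≤ x := by
  -- On a bounded window the projected vector is in the domain of `A`; its energy is the integral of
  -- a negative function there, yet non-negative, so the window is null.
  have key : ∀ n : ℕ, E.scalar f (Set.Ico (-n : ℝ) 0) = 0 := by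
    intro n
    have hS : MeasurableSet (Set.Ico (-n : ℝ) 0) := measurableSet_Ico
    have hb : ∀ᵐ x ∂(E.scalar f).restrict (Set.Ico (-n : ℝ) 0), x ∈ Set.Ico (-n : ℝ) 0 :=
      ae_restrict_mem hS
    have hmem : E.proj (Set.Ico (-n : ℝ) 0) f
        ∈ (E.integral (fun x => x) measurable_id).domain := by
      rw [mem_domain_integral, E.scalar_proj _ hS]
      refine (lintegral_mono_ae (g := fun _ => ENNReal.ofReal n ^ 2) ?_).trans_lt ?_
      · filter_upwards [hb] with x hx
        rw [Real.enorm_eq_ofReal_abs]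
        gcongr
        exact abs_le.2 ⟨hx.1, hx.2.le.trans n.cast_nonneg⟩
      · rw [lintegral_const]
        exact ENNReal.mul_lt_top (ENNReal.pow_lt_top ENNReal.ofReal_lt_top) (measure_lt_top _ _)
    have h1 := h ⟨_, hmem⟩
    rw [E.re_inner_integral_self] at h1
    simp only [E.scalar_proj _ hS] at h1
    have hint : Integrable (fun x : ℝ => -x) ((E.scalar f).restrict (Set.Ico (-n : ℝ) 0)) := by
      refine Integrable.of_bound (by fun_prop) n ?_
      filter_upwards [hb] with x hx
      rw [norm_neg, Real.norm_eq_abs]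
      exact abs_le.2 ⟨hx.1, hx.2.le.trans n.cast_nonneg⟩
    have hnn : 0 ≤ᵐ[(E.scalar f).restrict (Set.Ico (-n : ℝ) 0)] fun x : ℝ => -x := by
      filter_upwards [hb] with x hx
      simpa using hx.2.le
    have h2 : ∫ x in Set.Ico (-n : ℝ) 0, -x ∂E.scalar f = 0 := by
      refine le_antisymm ?_ (integral_nonneg_of_ae hnn)
      rw [integral_neg]
      linarith
    have h3 := (integral_eq_zero_iff_of_nonneg_ae hnn hint).1 h2
    have h4 : ∀ᵐ x ∂(E.scalar f).restrict (Set.Ico (-n : ℝ) 0), False := by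
      filter_upwards [hb, h3] with x hx hx0
      simp only [Pi.zero_apply, neg_eq_zero] at hx0
      exact hx.2.ne hx0
    exact Measure.restrict_eq_zero.1 (ae_eq_bot.1 (eventually_false_iff_eq_bot.1 h4))
  have h0 : E.scalar f (⋃ n : ℕ, Set.Ico (-n : ℝ) 0) = 0 := measure_iUnion_null key
  refine measure_mono_null (fun x hx => ?_) h0
  obtain ⟨n, hn⟩ := exists_nat_ge (-x)
  exact Set.mem_iUnion.2 ⟨n, by linarith, not_le.1 hx⟩

/-! ### The semigroup: smoothing, energy and decay. -/

section HeatDecay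

variable {E}

theorem mem_domain_exp {f : H} (hpos : ∀ᵐ x ∂E.scalar f, 0 ≤ x) {t : ℝ} (ht : 0 < t)
    {hm : Measurable fun x => Real.exp (-t * x)} :
    f ∈ (E.integral (fun x => Real.exp (-t * x)) hm).domain := by
  rw [mem_domain_integral]
  refine (lintegral_mono_ae (g := fun _ => 1) ?_).trans_lt ?_
  · filter_upwards [hpos] with x hx
    rw [Real.enorm_eq_ofReal_abs, abs_of_nonneg (Real.exp_nonneg _)]
    refine pow_le_one₀ zero_le (ENNReal.ofReal_le_one.2 (Real.exp_le_one_iff.2 ?_))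
    nlinarith
  · simp

/-- Smoothing, from `x e^{-tx} ≤ 1/t` for `x ≥ 0`. It allows the Nash inequality to be used on
`e^{-tA} f` when `f` itself, taken in the domain of `A^α`, is not in that of `A`. -/
theorem integral_exp_mem_domain {f : H} (hpos : ∀ᵐ x ∂E.scalar f, 0 ≤ x) {t : ℝ} (ht : 0 < t)
    {hm : Measurable fun x => Real.exp (-t * x)}
    (hf : f ∈ (E.integral (fun x => Real.exp (-t * x)) hm).domain) :
    E.integral (fun x => Real.exp (-t * x)) hm ⟨f, hf⟩
      ∈ (E.integral (fun x => x) measurable_id).domain := by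
  rw [mem_domain_integral, E.scalar_integral,
    lintegral_withDensity_eq_lintegral_mul _ (by fun_prop) (by fun_prop)]
  refine (lintegral_mono_ae (g := fun _ => ENNReal.ofReal t⁻¹ ^ 2) ?_).trans_lt ?_
  · filter_upwards [hpos] with x hx
    simp only [Pi.mul_apply]
    rw [← mul_pow, Real.enorm_eq_ofReal_abs, Real.enorm_eq_ofReal_abs,
      ← ENNReal.ofReal_mul (abs_nonneg _), abs_of_nonneg (Real.exp_nonneg _), abs_of_nonneg hx]
    gcongr
    have h1 := Real.add_one_le_exp (t * x)
    have h2 : Real.exp (-t * x) * Real.exp (t * x) = 1 := by rw [← Real.exp_add]; simp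
    have h3 := Real.exp_pos (-t * x)
    rw [inv_eq_one_div, le_div_iff₀ ht]
    nlinarith
  · rw [lintegral_const]
    exact ENNReal.mul_lt_top (ENNReal.pow_lt_top ENNReal.ofReal_lt_top) (measure_lt_top _ _)

theorem integral_scalar_exp {f : H} {t : ℝ} {hm : Measurable fun x => Real.exp (-t * x)}
    (hf : f ∈ (E.integral (fun x => Real.exp (-t * x)) hm).domain) (g : ℝ → ℝ) :
    ∫ x, g x ∂E.scalar (E.integral (fun x => Real.exp (-t * x)) hm ⟨f, hf⟩)
      = ∫ x, Real.exp (-(2 * t) * x) * g x ∂E.scalar f := by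
  rw [E.scalar_integral, integral_withDensity_eq_integral_toReal_smul (by fun_prop)
    (Eventually.of_forall fun x => ENNReal.pow_lt_top enorm_lt_top)]
  refine integral_congr_ae (Eventually.of_forall fun x => ?_)
  simp only [ENNReal.toReal_pow, toReal_enorm, Real.norm_eq_abs, sq_abs, smul_eq_mul]
  rw [← Real.exp_nat_mul]
  congr 2
  push_cast
  ring

theorem norm_sq_eq_integral (f : H) : ‖f‖ ^ 2 = ∫ _, (1 : ℝ) ∂E.scalar f := by
  rw [integral_const, measureReal_def, E.scalar_univ, ENNReal.toReal_ofReal (by positivity)]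
  simp

theorem norm_sq_integral_exp {f : H} {t : ℝ} {hm : Measurable fun x => Real.exp (-t * x)}
    (hf : f ∈ (E.integral (fun x => Real.exp (-t * x)) hm).domain) :
    ‖E.integral (fun x => Real.exp (-t * x)) hm ⟨f, hf⟩‖ ^ 2
      = ∫ x, Real.exp (-(2 * t) * x) ∂E.scalar f := by
  rw [E.norm_sq_eq_integral, integral_scalar_exp]
  simp

theorem integrable_exp {f : H} (hpos : ∀ᵐ x ∂E.scalar f, 0 ≤ x) {t : ℝ} (ht : 0 < t) :
    Integrable (fun x => Real.exp (-t * x)) (E.scalar f) := by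
  refine Integrable.of_bound (by fun_prop) 1 ?_
  filter_upwards [hpos] with x hx
  rw [Real.norm_eq_abs, abs_of_nonneg (Real.exp_nonneg _)]
  exact Real.exp_le_one_iff.2 (by nlinarith)

/-- The energy of `e^{-tA} f` is controlled by the loss of norm: as `x e^{-x} ≤ 1 - e^{-x}`,
`2t (A e^{-tA} f, e^{-tA} f) ≤ ‖f‖² - ‖e^{-tA} f‖²`. -/
theorem energy_exp_le {f : H} (hpos : ∀ᵐ x ∂E.scalar f, 0 ≤ x) {t : ℝ} (ht : 0 < t)
    {hm : Measurable fun x => Real.exp (-t * x)}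
    (hf : f ∈ (E.integral (fun x => Real.exp (-t * x)) hm).domain)
    (hg : E.integral (fun x => Real.exp (-t * x)) hm ⟨f, hf⟩
      ∈ (E.integral (fun x => x) measurable_id).domain) :
    2 * t * RCLike.re ⟪E.integral (fun x => x) measurable_id ⟨_, hg⟩,
        E.integral (fun x => Real.exp (-t * x)) hm ⟨f, hf⟩⟫_𝕜
      ≤ ‖f‖ ^ 2 - ‖E.integral (fun x => Real.exp (-t * x)) hm ⟨f, hf⟩‖ ^ 2 := by
  have h1 := E.re_inner_integral_self ⟨_, hg⟩
  simp only at h1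
  have hint : Integrable (fun x : ℝ => 1 - Real.exp (-(2 * t) * x)) (E.scalar f) :=
    (integrable_const 1).sub (integrable_exp hpos (by positivity))
  rw [h1, integral_scalar_exp, norm_sq_integral_exp, E.norm_sq_eq_integral f, ← integral_sub
    (integrable_const 1) (integrable_exp hpos (by positivity)), ← integral_const_mul]
  refine integral_mono_of_nonneg ?_ hint ?_
  · filter_upwards [hpos] with x hx
    simp only [Pi.zero_apply]
    positivity
  · refine Eventually.of_forall fun x => ?_
    simp only
    have h2 := Real.add_one_le_exp (2 * t * x)
    have h3 : Real.exp (-(2 * t) * x) * Real.exp (2 * t * x) = 1 := by rw [← Real.exp_add]; simp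
    nlinarith [Real.exp_pos (-(2 * t) * x)]

/-- If `‖e^{-tA} f‖² ≤ ‖f‖² / 4`, then at least half of the spectral mass of `f` lies above
`1 / (4t)`, so that `(A^α f, f)` is bounded from below. -/
theorem rpow_energy_ge {f : H} (hpos : ∀ᵐ x ∂E.scalar f, 0 ≤ x) {t : ℝ} (ht : 0 < t)
    {hm : Measurable fun x => Real.exp (-t * x)}
    (hf : f ∈ (E.integral (fun x => Real.exp (-t * x)) hm).domain)
    (hdecay : ‖E.integral (fun x => Real.exp (-t * x)) hm ⟨f, hf⟩‖ ^ 2 ≤ ‖f‖ ^ 2 / 4)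
    {α : ℝ} (hα : 0 < α) {hm' : Measurable fun x : ℝ => x ^ α}
    (hf' : f ∈ (E.integral (fun x => x ^ α) hm').domain) :
    (1 / (4 * t)) ^ α * (‖f‖ ^ 2 / 2)
      ≤ RCLike.re ⟪E.integral (fun x => x ^ α) hm' ⟨f, hf'⟩, f⟫_𝕜 := by
  have h1 := E.re_inner_integral_self ⟨f, hf'⟩
  simp only at h1
  have hint : Integrable (fun x : ℝ => x ^ α) (E.scalar f) := by
    refine MemLp.integrable (q := 2) (by norm_num) ⟨hm'.aestronglyMeasurable, ?_⟩
    rw [eLpNorm_lt_top_iff_lintegral_rpow_enorm_lt_top two_ne_zero ENNReal.ofNat_ne_top]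
    simpa using E.mem_domain_integral.1 hf'
  have hexp := integrable_exp hpos (t := 2 * t) (by positivity)
  -- Pointwise comparison: for `x ≤ 1/(4t)` one has `e^{-2tx} ≥ 1 - 2tx ≥ 1/2`, so the left
  -- integrand is at most zero; beyond that point its second factor is at most 1. The left side
  -- integrates to `(1/(4t))^α (‖f‖² - 2‖e^{-tA} f‖²)`.
  have h2 : ∫ x, (1 / (4 * t)) ^ α * (1 - 2 * Real.exp (-(2 * t) * x)) ∂E.scalar f
      ≤ ∫ x, x ^ α ∂E.scalar f := by
    refine integral_mono_ae (((integrable_const 1).sub (hexp.const_mul 2)).const_mul _) hint ?_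
    filter_upwards [hpos] with x hx
    have hr : 0 < (1 / (4 * t)) ^ α := by positivity
    rcases le_total x (1 / (4 * t)) with hxr | hxr
    · have h3 := Real.add_one_le_exp (-(2 * t) * x)
      have h4 : t * x ≤ 1 / 4 := by
        calc t * x ≤ t * (1 / (4 * t)) := by gcongr
          _ = 1 / 4 := by field_simp
      have h5 : 0 ≤ x ^ α := by positivity
      nlinarith
    · have h3 : (1 / (4 * t)) ^ α ≤ x ^ α := by gcongr
      nlinarith [Real.exp_pos (-(2 * t) * x)]
  rw [integral_const_mul, integral_sub (integrable_const 1) (hexp.const_mul 2),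
    integral_const_mul, ← norm_sq_integral_exp hf, ← E.norm_sq_eq_integral f] at h2
  rw [h1]
  refine le_trans ?_ h2
  gcongr
  linarith

end HeatDecay

end SpectralMeasure

/-! ### From the Nash inequality for `A` to the one for `A^α`. -/

section Nash

variable {𝕜 : Type*} [RCLike 𝕜] {X : Type*} [MeasurableSpace X] {μ : Measure X}

/-- A Nash inequality with `Θ(x) ≥ c x B(k x)`, extended by homogeneity to `‖f‖₁ ≤ 1`. -/
theorem NashInequality.le_of_eLpNorm_le_one {A : Lp 𝕜 2 μ →ₗ.[𝕜] Lp 𝕜 2 μ} {Θ : ℝ≥0 → ℝ≥0}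
    (hN : NashInequality A Θ) {B : ℝ≥0 → ℝ≥0} (hB : Monotone B) {c k : ℝ≥0}
    (hΘ : ∀ x > 0, c * x * B (k * x) ≤ Θ x) (f : A.domain) (hf0 : (f : Lp 𝕜 2 μ) ≠ 0)
    (hf1 : eLpNorm (f : Lp 𝕜 2 μ) 1 μ ≤ 1) :
    ((c * ‖(f : Lp 𝕜 2 μ)‖₊ ^ 2 * B (k * ‖(f : Lp 𝕜 2 μ)‖₊ ^ 2) : ℝ≥0) : ℝ)
      ≤ RCLike.re ⟪A f, (f : Lp 𝕜 2 μ)⟫_𝕜 := by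
  obtain ⟨m, hm⟩ : ∃ m : ℝ≥0, eLpNorm (f : Lp 𝕜 2 μ) 1 μ = m :=
    ⟨_, (ENNReal.coe_toNNReal (hf1.trans_lt ENNReal.one_lt_top).ne).symm⟩
  have hm1 : m ≤ 1 := by
    rw [hm] at hf1
    exact_mod_cast hf1
  have hm0 : 0 < m := by
    rw [pos_iff_ne_zero]
    rintro rfl
    rw [ENNReal.coe_zero, eLpNorm_eq_zero_iff (Lp.aestronglyMeasurable _) one_ne_zero] at hm
    exact hf0 ((Lp.eq_zero_iff_ae_eq_zero).2 hm)
  have hmi : 1 ≤ m⁻¹ := (one_le_inv₀ hm0).2 hm1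
  have hg : ((((m⁻¹ : ℝ≥0) : ℝ) : 𝕜) • f : A.domain) = (((m⁻¹ : ℝ≥0) : ℝ) : 𝕜) • (f : Lp 𝕜 2 μ) :=
    rfl
  have hnn : ‖((((m⁻¹ : ℝ≥0) : ℝ) : 𝕜))‖₊ = m⁻¹ := by
    ext
    simp
  have h1 := hN ((((m⁻¹ : ℝ≥0) : ℝ) : 𝕜) • f) (by
    rw [hg, eLpNorm_congr_ae (Lp.coeFn_smul _ _), eLpNorm_const_smul, hm, enorm_eq_nnnorm, hnn,
      ← ENNReal.coe_mul, inv_mul_cancel₀ hm0.ne', ENNReal.coe_one])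
  rw [hg, A.map_smul, nnnorm_smul, hnn, inner_smul_left, inner_smul_right, RCLike.conj_ofReal,
    ← mul_assoc, ← RCLike.ofReal_mul, RCLike.re_ofReal_mul, mul_pow] at h1
  have hs : 0 < ‖(f : Lp 𝕜 2 μ)‖₊ ^ 2 := by
    have := nnnorm_pos.2 hf0
    positivity
  set s := ‖(f : Lp 𝕜 2 μ)‖₊ ^ 2
  -- Normalising `f` by `m⁻¹ ≥ 1` only increases the argument of `B`; the remaining factor `m⁻²`
  -- cancels against the energy.
  have h2 : c * (m⁻¹ ^ 2 * s) * B (k * s) ≤ Θ (m⁻¹ ^ 2 * s) := by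
    refine le_trans ?_ (hΘ _ (by positivity))
    gcongr
    refine hB ?_
    gcongr
    exact le_mul_of_one_le_left zero_le (one_le_pow₀ hmi)
  have h3 : ((c * (m⁻¹ ^ 2 * s) * B (k * s) : ℝ≥0) : ℝ) ≤ _ := (NNReal.coe_le_coe.2 h2).trans h1
  have h4 : 0 < ((m⁻¹ : ℝ≥0) : ℝ) * ((m⁻¹ : ℝ≥0) : ℝ) := by positivity
  refine le_of_mul_le_mul_left (le_trans (le_of_eq ?_) h3) h4
  push_cast
  ring

/-- The fractional Nash inequality for an operator given by a spectral measure. -/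
theorem SpectralMeasure.nash_rpow (E : SpectralMeasure 𝕜 (Lp 𝕜 2 μ))
    (hnonneg : ∀ f : (E.integral (fun x => x) measurable_id).domain,
      0 ≤ RCLike.re ⟪E.integral (fun x => x) measurable_id f, (f : Lp 𝕜 2 μ)⟫_𝕜)
    (hcontr : ∀ t : ℝ, 0 < t →
      ∀ f : (E.integral (fun x => Real.exp (-t * x)) (by fun_prop)).domain,
        eLpNorm (E.integral (fun x => Real.exp (-t * x)) (by fun_prop) f) 1 μ
          ≤ eLpNorm (f : Lp 𝕜 2 μ) 1 μ)
    {Θ : ℝ≥0 → ℝ≥0} (hN : NashInequality (E.integral (fun x => x) measurable_id) Θ)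
    {B : ℝ≥0 → ℝ≥0} (hB : Monotone B) {c k : ℝ≥0} (hc : 0 < c)
    (hΘ : ∀ x > 0, c * x * B (k * x) ≤ Θ x) {α : ℝ} (hα : 0 < α) :
    NashInequality (E.integral (fun x => x ^ α) (by fun_prop))
      (fun x => (c / 6) ^ α / 2 * (x * B (k / 4 * x) ^ α)) := by
  intro f hf1
  have hpos := E.ae_nonneg_of_nonneg hnonneg (f : Lp 𝕜 2 μ)
  set s : ℝ≥0 := ‖(f : Lp 𝕜 2 μ)‖₊ ^ 2 with hs
  set b := B (k / 4 * s) with hb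
  have hs' : ‖(f : Lp 𝕜 2 μ)‖ ^ 2 = s := by simp [hs]
  -- For `b = 0` no finite time satisfies `2tcb = 3`, but the claim is then just non-negativity of
  -- `A^α`, as `0 ^ α = 0` for `α > 0`.
  rcases eq_or_ne b 0 with hb0 | hb0
  · simp only [← hb]
    rw [hb0, NNReal.zero_rpow hα.ne', E.re_inner_integral_self]
    simp only [mul_zero, NNReal.coe_zero]
    refine integral_nonneg_of_ae ?_
    filter_upwards [hpos] with x hx
    exact Real.rpow_nonneg hx α
  have hbpos : (0 : ℝ) < b := NNReal.coe_pos.2 (pos_iff_ne_zero.2 hb0)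
  have hcpos : (0 : ℝ) < c := hc
  -- Chosen so that `2tcb = 3`: Nash and the energy bound then give `3‖g‖² ≤ ‖f‖² - ‖g‖²`.
  set t : ℝ := 3 / (2 * c * b) with ht
  have htpos : 0 < t := by positivity
  have hm : Measurable fun x => Real.exp (-t * x) := by fun_prop
  have hft := mem_domain_exp hpos htpos (hm := hm)
  have hgt := integral_exp_mem_domain hpos htpos hft
  have henergy := energy_exp_le hpos htpos hft hgt
  have hcon := hcontr t htpos ⟨f, hft⟩
  rw [hf1] at hcon
  set g := E.integral (fun x => Real.exp (-t * x)) hm ⟨f, hft⟩ with hg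
  have hdecay : ‖g‖ ^ 2 ≤ ‖(f : Lp 𝕜 2 μ)‖ ^ 2 / 4 := by
    by_contra! hlt
    have hg0 : g ≠ 0 := by
      rintro h0
      rw [h0] at hlt
      simp only [norm_zero, ne_eq, OfNat.ofNat_ne_zero, not_false_eq_true, zero_pow] at hlt
      nlinarith [sq_nonneg ‖(f : Lp 𝕜 2 μ)‖]
    have hnash := hN.le_of_eLpNorm_le_one hB hΘ ⟨g, hgt⟩ hg0 hcon
    have hbB : b ≤ B (k * ‖g‖₊ ^ 2) := by
      refine hB ?_
      have : s / 4 ≤ ‖g‖₊ ^ 2 := by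
        rw [← NNReal.coe_le_coe]
        push_cast
        rw [← hs']
        exact hlt.le
      calc k / 4 * s = k * (s / 4) := by ring
        _ ≤ _ := by gcongr
    have h1 : (c : ℝ) * ‖g‖ ^ 2 * b ≤ RCLike.re ⟪E.integral (fun x => x) measurable_id ⟨g, hgt⟩,
        g⟫_𝕜 := by
      refine le_trans ?_ hnash
      push_cast
      gcongr
    have h2 : 2 * t * (c * ‖g‖ ^ 2 * b) = 3 * ‖g‖ ^ 2 := by
      rw [ht]
      field_simp
    have h3 : 2 * t * (c * ‖g‖ ^ 2 * b) ≤ 2 * t * _ := mul_le_mul_of_nonneg_left h1 (by positivity)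
    linarith
  have hmain := rpow_energy_ge hpos htpos hft hdecay hα f.2
  refine le_trans (le_of_eq ?_) hmain
  -- This threshold energy is the source of the constant `c / 6` in the conclusion.
  have hr : 1 / (4 * t) = c / 6 * b := by
    rw [ht]
    field_simp
    norm_num
  rw [hr, Real.mul_rpow (by positivity) (by positivity), hs']
  push_cast
  ring

theorem funEquiv_const_mul_comp {m : ℝ≥0 → ℝ≥0} {a k : ℝ≥0} (ha : 0 < a) (hk : 0 < k) :
    FunEquiv (fun x => a * m (k * x)) m := by
  refine ⟨⟨a, ha, k, hk, fun t _ => le_rfl⟩, a⁻¹, inv_pos.2 ha, k⁻¹, inv_pos.2 hk, fun t _ => ?_⟩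
  simp only
  rw [inv_mul_cancel_left₀ ha.ne', mul_inv_cancel_left₀ hk.ne']

/-- Substituting `C₂⁻¹ x` for the variable moves the inner constant onto `B`, giving `c = C₁⁻¹ C₂⁻¹`
and `k = C₂⁻¹`. -/
theorem FunDominated.exists_lower_bound {B Θ : ℝ≥0 → ℝ≥0}
    (h : FunDominated (fun x => x * B x) Θ) :
    ∃ c > 0, ∃ k > 0, ∀ x > 0, c * x * B (k * x) ≤ Θ x := by
  obtain ⟨C₁, h₁, C₂, h₂, h⟩ := h
  refine ⟨C₁⁻¹ * C₂⁻¹, by positivity, C₂⁻¹, by positivity, fun x hx => ?_⟩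
  have h3 := h (C₂⁻¹ * x) (by positivity)
  simp only [mul_inv_cancel_left₀ h₂.ne'] at h3
  calc C₁⁻¹ * C₂⁻¹ * x * B (C₂⁻¹ * x) = C₁⁻¹ * (C₂⁻¹ * x * B (C₂⁻¹ * x)) := by ring
    _ ≤ C₁⁻¹ * (C₁ * Θ x) := by gcongr
    _ = Θ x := inv_mul_cancel_left₀ h₁.ne' _

end Nash

theorem mainTheorem1 {𝕜 : Type*} [RCLike 𝕜] {X : Type*} [MeasurableSpace X] (μ : Measure X)
    [SigmaFinite μ] (A : Lp 𝕜 2 μ →ₗ.[𝕜] Lp 𝕜 2 μ) (hA : IsSelfAdjoint A)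
    (hA_nonneg : ∀ f : A.domain, 0 ≤ RCLike.re ⟪A f, (f : Lp 𝕜 2 μ)⟫_𝕜)
    (hA_contr : IsL1Contractive A)
    (B : ℝ≥0 → ℝ≥0) (hB_mono : Monotone B) (hB_lim : Tendsto B atTop atTop)
    (hNash : NashInequalityModEquiv A (fun x => x * B x))
    (α : ℝ) (hα : 0 < α) :
    NashInequalityModEquiv (A.fracPow α) (fun x => x * B x ^ α) := by
  obtain ⟨Θ, ⟨-, hdom⟩, hN⟩ := hNash
  obtain ⟨c, hc, k, hk, hΘ⟩ := hdom.exists_lower_bound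
  by_cases h : ∃ E : SpectralMeasure 𝕜 (Lp 𝕜 2 μ), E.integral (fun x => x) measurable_id = A
  -- One and the same resolution `E` serves `A`, `e^{-tA}` and `A^α`, so contractivity and the Nash
  -- inequality can be combined.
  · have hcalc : ∀ (φ : ℝ → ℝ) (hφ : Measurable φ),
        A.borelCalculus φ hφ = h.choose.integral φ hφ := fun φ hφ => dif_pos h
    have hE := h.choose_spec
    generalize h.choose = E at hcalc hE
    have hcontr : ∀ t : ℝ, 0 < t →
        ∀ f : (E.integral (fun x => Real.exp (-t * x)) (by fun_prop)).domain,
          eLpNorm (E.integral (fun x => Real.exp (-t * x)) (by fun_prop) f) 1 μ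
            ≤ eLpNorm (f : Lp 𝕜 2 μ) 1 μ := by
      intro t ht
      have h1 := hA_contr t ht
      rwa [show A.expNeg t = _ from hcalc _ _] at h1
    rw [← hE] at hA_nonneg hN
    refine ⟨fun x => (c / 6) ^ α / 2 * (x * B (k / 4 * x) ^ α), ?_, ?_⟩
    -- The extra factor `(k / 4)⁻¹` compensates for the prefactor `x`, which is not rescaled in the
    -- function obtained.
    · have h1 := funEquiv_const_mul_comp (m := fun x => x * B x ^ α)
        (a := (c / 6) ^ α / 2 * (k / 4)⁻¹) (k := k / 4)
        (mul_pos (half_pos (NNReal.rpow_pos (by positivity))) (by positivity)) (by positivity)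
      convert h1 using 2 with x
      have hk4 : k / 4 ≠ 0 := by positivity
      rw [mul_assoc, mul_assoc, inv_mul_cancel_left₀ hk4]
    · rw [LinearPMap.fracPow, hcalc]
      exact E.nash_rpow hA_nonneg hcontr hN hB_mono hc hΘ hα
  · -- By the spectral theorem `A` has a spectral resolution, so that this case does not occur.
    refine ⟨_, ⟨⟨1, one_pos, 1, one_pos, fun t _ => by rw [one_mul, one_mul]⟩,
      1, one_pos, 1, one_pos, fun t _ => by rw [one_mul, one_mul]⟩, ?_⟩
    -- Formally the power is now `⊥`, with domain `{0}`, and no vector there has `L¹` norm 1: the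
    -- inequality is vacuous.
    rw [LinearPMap.fracPow, LinearPMap.borelCalculus, dif_neg h]
    rintro ⟨f, hf⟩ hf1
    obtain rfl : f = 0 := (Submodule.mem_bot 𝕜).1 hf
    rw [eLpNorm_congr_ae (Lp.coeFn_zero _ _ _), eLpNorm_zero] at hf1
    exact absurd hf1 zero_ne_one
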